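/- Let $\{Y_k\}_{k\in\mathbb Z}$ be a real sequence that is fourth-order stationary (finite fourth moments, and all joint moments of order at most $4$ are invariant under time shifts) with mean $0$ and autocovariances $\gamma_j=\mathrm{Cov}(Y_0,Y_j)$. Put $$\kappa(h,r,s)=E[Y_0Y_hY_rY_s]-(\gamma_h\gamma_{r-s}+\gamma_r\gamma_{h-s}+\gamma_s\gamma_{h-r}),$$ and assume that, for some $\sigma>0$ and a Wiener process $W$, $$n^{-1/2}\sum_{1\le j\le nt}Y_j\xrightarrow{d}\sigma W(t)\ \text{ in } D[0,1]\ (\text{Skorokhod topology}),\qquad \sum_{j\in\mathbb Z}|\gamma_j|<\infty,\qquad \sup_{h\in\mathbb Z}\sum_{r,s\in\mathbb Z}|\kappa(h,r,s)|<\infty .$$ For each $n$ let the observations $X_1,\dots,X_n$ be given by $X_i=\mu+Y_i$ for $1\le i\le k^*$ and $X_i=\mu+\Delta+Y_i$ for $k^*<i\le n$, where $\mu\in\mathbb R$ is fixed, $\Delta=\Delta_n\in\mathbb R$ and $k^*=k^*_n$ depend on $n$, and $k^*=\lfloor n\theta\rfloor$ for some fixed $0<\theta<1$. Let $\bar X_n=\frac1n\sum_{1\le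 i\le n}X_i$, let $q(n)$ be natural numbers, and put $$\hat\gamma_j=\frac1n\sum_{1\le i\le n-j}(X_i-\bar X_n)(X_{i+j}-\bar X_n),\qquad s_n^2=\hat\gamma_0+2\sum_{1\le j\le q(n)}\Bigl(1-\frac{j}{q(n)+1}\Bigr)\hat\gamma_j ,$$ $$T_n=\frac{1}{n^{1/2}s_n}\max_{1\le k\le n}\Bigl|\sum_{1\le i\le k}X_i-\frac kn\sum_{1\le i\le n}X_i\Bigr| ,$$ with $T_n:=0$ when $s_n=0$. Let $\hat k$ be the smallest $k\in\{1,\dots,n\}$ at which the maximum in $T_n$ is attained. Assume that, as $n\to\infty$, $$n\Delta^2\to\infty,\qquad \Delta^2|\hat k-k^*|=O_P(1),\qquad q(n)\Delta^2=O(1),\qquad q(n)\to\infty,\qquad \frac{q(n)}{n}\to0 .$$ Then $T_n\to\infty$ in probability; that is, $P(T_n\le M)\to0$ for every $M\in\mathbb R$. -/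

import Mathlib

open MeasureTheory ProbabilityTheory Filter Topology
open scoped ENNReal NNReal

noncomputable section

namespace ChangePoint

/-! ### The Skorokhod space `D[0,1]` -/

/-- A function on `[0,1]` is càdlàg: right-continuous with left limits. -/
def IsCadlag (f : unitInterval → ℝ) : Prop :=
  ∀ t : unitInterval, ContinuousWithinAt f (Set.Ici t) t ∧ ∃ l : ℝ, Tendsto f (𝓝[<] t) (𝓝 l)

/-- The space `D[0,1]` of real càdlàg functions on `[0,1]`. -/
def SkorokhodSpace : Type := {f : unitInterval → ℝ // IsCadlag f}

instance : CoeFun SkorokhodSpace (fun _ => unitInterval → ℝ) := ⟨fun x => x.1⟩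

/-- The Skorokhod distance: the infimum over time changes `lam` (increasing bijections of `[0,1]`)
of `max (sup_t |lam t - t|) (sup_t |x t - y (lam t)|)`. -/
def skorokhodEDist (x y : SkorokhodSpace) : ℝ≥0∞ :=
  ⨅ lam : unitInterval ≃o unitInterval, max (⨆ t, edist (lam t) t) (⨆ t, edist (x t) (y (lam t)))

theorem skorokhodEDist_self (x : SkorokhodSpace) : skorokhodEDist x x = 0 := by
  refine le_antisymm ((iInf_le _ (OrderIso.refl unitInterval)).trans ?_) bot_le
  simp

theorem skorokhodEDist_comm_le (x y : SkorokhodSpace) :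
    skorokhodEDist x y ≤ skorokhodEDist y x := by
  refine le_iInf fun lam => (iInf_le _ lam.symm).trans ?_
  refine max_le_max (iSup_le fun t => ?_) (iSup_le fun t => ?_)
  · refine le_trans ?_ (le_iSup _ (lam.symm t))
    simp [edist_comm]
  · refine le_trans ?_ (le_iSup _ (lam.symm t))
    simp [edist_comm]

theorem skorokhodEDist_triangle (x y z : SkorokhodSpace) :
    skorokhodEDist x z ≤ skorokhodEDist x y + skorokhodEDist y z := by
  unfold skorokhodEDist
  rw [ENNReal.iInf_add]
  refine le_iInf fun lam => ?_
  rw [ENNReal.add_iInf]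
  refine le_iInf fun nu => (iInf_le _ (lam.trans nu)).trans ?_
  refine max_le (iSup_le fun t => ?_) (iSup_le fun t => ?_)
  · refine (edist_triangle _ (lam t) _).trans ?_
    rw [add_comm]
    refine add_le_add ?_ ?_
    · exact le_trans (le_iSup (fun t => edist (lam t) t) t) (le_max_left _ _)
    · exact le_trans (le_iSup (fun t => edist (nu t) t) (lam t)) (le_max_left _ _)
  · refine (edist_triangle _ (y (lam t)) _).trans ?_
    refine add_le_add ?_ ?_
    · exact le_trans (le_iSup (fun t => edist (x t) (y (lam t))) t) (le_max_right _ _)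
    · exact le_trans (le_iSup (fun t => edist (y t) (z (nu t))) (lam t)) (le_max_right _ _)

instance : PseudoEMetricSpace SkorokhodSpace where
  edist := skorokhodEDist
  edist_self := skorokhodEDist_self
  edist_comm x y := le_antisymm (skorokhodEDist_comm_le x y) (skorokhodEDist_comm_le y x)
  edist_triangle := skorokhodEDist_triangle

instance : MeasurableSpace SkorokhodSpace := borel SkorokhodSpace

instance : BorelSpace SkorokhodSpace := ⟨rfl⟩

/-! ### The partial sum process -/

/-- The path `t ↦ n^{-1/2} ∑_{1 ≤ j ≤ nt} y_j`, `t ∈ [0,1]`. -/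
def partialSumPath (y : ℤ → ℝ) (n : ℕ) (t : unitInterval) : ℝ :=
  (Real.sqrt n)⁻¹ * ∑ j ∈ Finset.Icc 1 ⌊(n : ℝ) * t⌋₊, y j

theorem isCadlag_partialSumPath (y : ℤ → ℝ) (n : ℕ) : IsCadlag (partialSumPath y n) := by
  intro t
  let g : ℤ → ℝ := fun m => (Real.sqrt n)⁻¹ * ∑ j ∈ Finset.Icc 1 m.toNat, y j
  have hg : partialSumPath y n = fun s : unitInterval => g ⌊(n : ℝ) * s⌋ := rfl
  have hc : Continuous fun s : unitInterval => (n : ℝ) * (s : ℝ) := by fun_prop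
  constructor
  · have h1 : Tendsto (fun s : unitInterval => (n : ℝ) * (s : ℝ)) (𝓝[≥] t) (𝓝[≥] ((n : ℝ) * t)) := by
      refine tendsto_nhdsWithin_iff.2 ⟨hc.continuousAt.mono_left nhdsWithin_le_nhds, ?_⟩
      filter_upwards [self_mem_nhdsWithin] with s hs
      have hs' : (t : ℝ) ≤ s := hs
      exact mul_le_mul_of_nonneg_left hs' (Nat.cast_nonneg n)
    have h2 := (tendsto_floor_right_pure_floor ((n : ℝ) * t)).comp h1
    rw [ContinuousWithinAt, hg]
    exact ((tendsto_pure_nhds g _).comp h2)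
  · rcases Nat.eq_zero_or_pos n with rfl | hn
    · refine ⟨0, ?_⟩
      simpa [hg, g] using tendsto_const_nhds
    · have h1 : Tendsto (fun s : unitInterval => (n : ℝ) * (s : ℝ)) (𝓝[<] t) (𝓝[<] ((n : ℝ) * t)) := by
        refine tendsto_nhdsWithin_iff.2 ⟨hc.continuousAt.mono_left nhdsWithin_le_nhds, ?_⟩
        filter_upwards [self_mem_nhdsWithin] with s hs
        have hs' : (s : ℝ) < t := hs
        exact mul_lt_mul_of_pos_left hs' (Nat.cast_pos.2 hn)
      have h2 := (tendsto_floor_left_pure_ceil_sub_one ((n : ℝ) * t)).comp h1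
      rw [hg]
      exact ⟨_, (tendsto_pure_nhds g _).comp h2⟩

/-- The partial sum process of `Y` as a map into `D[0,1]`. -/
def partialSumProcess {Ω : Type*} (Y : ℤ → Ω → ℝ) (n : ℕ) (ω : Ω) : SkorokhodSpace :=
  ⟨partialSumPath (fun j => Y j ω) n, isCadlag_partialSumPath _ n⟩

/-! ### The assumptions on the error sequence -/

section Errors

variable {Ω : Type*} [MeasurableSpace Ω]

/-- Fourth-order stationarity: finite fourth moments, and all joint moments of order at most four
are invariant under time shifts. -/
structure FourthOrderStationary (Y : ℤ → Ω → ℝ) (P : Measure Ω) : Prop where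
  memLp : ∀ k, MemLp (Y k) 4 P
  moment_shift : ∀ m : ℕ, m ≤ 4 → ∀ (t : Fin m → ℤ) (k : ℤ),
    ∫ ω, ∏ i, Y (t i + k) ω ∂P = ∫ ω, ∏ i, Y (t i) ω ∂P

/-- The autocovariance `γ_j = Cov(Y_0, Y_j)`. -/
def autocov (Y : ℤ → Ω → ℝ) (P : Measure Ω) (j : ℤ) : ℝ :=
  covariance (Y 0) (Y j) P

/-- The fourth-order cumulant `κ(h,r,s)` of a mean zero fourth-order stationary sequence. -/
def cumulant4 (Y : ℤ → Ω → ℝ) (P : Measure Ω) (h r s : ℤ) : ℝ :=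
  (∫ ω, Y 0 ω * Y h ω * Y r ω * Y s ω ∂P) -
    (autocov Y P h * autocov Y P (r - s) + autocov Y P r * autocov Y P (h - s)
      + autocov Y P s * autocov Y P (h - r))

/-- `n^{-1/2} ∑_{1 ≤ j ≤ nt} Y_j → σ W(t)` in distribution in `D[0,1]`, with `W` a Wiener process:
weak convergence of the laws on `D[0,1]` with the Skorokhod topology and its Borel sets. -/
def FunctionalCLT (Y : ℤ → Ω → ℝ) (P : Measure Ω) [IsProbabilityMeasure P] (σ : ℝ) : Prop :=
  ∃ (Ω' : Type) (_ : MeasurableSpace Ω') (P' : Measure Ω') (_ : IsProbabilityMeasure P')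
    (W : ℝ≥0 → Ω' → ℝ) (Z : Ω' → SkorokhodSpace),
    IsBrownianReal W P' ∧
    (∀ᵐ ω ∂P', ∀ t : unitInterval, Z ω t = σ * W (unitInterval.toNNReal t) ω) ∧
    TendstoInDistribution (fun n : ℕ => partialSumProcess Y n) atTop Z (fun _ => P) P'

/-- The weak dependence assumption on the errors. -/
structure WeaklyDependent (Y : ℤ → Ω → ℝ) (P : Measure Ω) [IsProbabilityMeasure P] : Prop where
  stationary : FourthOrderStationary Y P
  mean_zero : ∀ k, ∫ ω, Y k ω ∂P = 0
  fclt : ∃ σ : ℝ, 0 < σ ∧ FunctionalCLT Y P σ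
  summable_autocov : Summable fun j : ℤ => |autocov Y P j|
  cumulant_bound :
    (⨆ h : ℤ, ∑' p : ℤ × ℤ, ENNReal.ofReal |cumulant4 Y P h p.1 p.2|) < ∞

/-- The triangular array `X` follows the change-point model with base mean `μ`, shift `Δ n`,
change time `kstar n` and errors `Y`. -/
def FollowsChangePointModel (X : ℕ → ℕ → Ω → ℝ) (Y : ℤ → Ω → ℝ) (μ : ℝ) (Δ : ℕ → ℝ)
    (kstar : ℕ → ℕ) : Prop :=
  ∀ n i : ℕ, 1 ≤ i → i ≤ n → ∀ ω,
    X n i ω = if i ≤ kstar n then μ + Y i ω else μ + Δ n + Y i ω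

/-- `Z_n = O_P(1)`. -/
def IsBoundedInProbability (Z : ℕ → Ω → ℝ) (P : Measure Ω) : Prop :=
  ∀ ε : ℝ≥0∞, 0 < ε → ∃ C : ℝ, ∀ᶠ n in atTop, P {ω | C < |Z n ω|} ≤ ε

/-- `Z_n → ∞` in probability. -/
def TendstoInfinityInProbability (Z : ℕ → Ω → ℝ) (P : Measure Ω) : Prop :=
  ∀ M : ℝ, Tendsto (fun n => P {ω | Z n ω ≤ M}) atTop (𝓝 0)

end Errors

/-! ### The statistics computed from a sample `x 1, …, x n` -/

/-- `|∑_{1 ≤ i ≤ k} x_i - (k/n) ∑_{1 ≤ i ≤ n} x_i|`. -/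
def cusum (x : ℕ → ℝ) (n k : ℕ) : ℝ :=
  |∑ i ∈ Finset.Icc 1 k, x i - (k / n : ℝ) * ∑ i ∈ Finset.Icc 1 n, x i|

/-- `max_{1 ≤ k ≤ n}` of the CUSUM process. -/
def maxCusum (x : ℕ → ℝ) (n : ℕ) : ℝ :=
  ⨆ k : Finset.Icc 1 n, cusum x n k

/-- The change-point estimator: the first `k ∈ {1,…,n}` where the CUSUM maximum is attained. -/
def changePointEstimator (x : ℕ → ℝ) (n : ℕ) : ℕ :=
  sInf {k : ℕ | 1 ≤ k ∧ k ≤ n ∧ maxCusum x n = cusum x n k}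

/-- The sample mean. -/
def sampleMean (x : ℕ → ℝ) (n : ℕ) : ℝ :=
  (n : ℝ)⁻¹ * ∑ i ∈ Finset.Icc 1 n, x i

/-- The sample autocovariance at lag `j`. It is an empty sum, hence zero, for `j ≥ n`. -/
def sampleAutocov (x : ℕ → ℝ) (n j : ℕ) : ℝ :=
  (n : ℝ)⁻¹ * ∑ i ∈ Finset.Icc 1 (n - j), (x i - sampleMean x n) * (x (i + j) - sampleMean x n)

/-- The Bartlett weight `ω_j(q) = 1 - j/(q+1)`. -/
def bartlettWeight (q j : ℕ) : ℝ := 1 - (j : ℝ) / ((q : ℝ) + 1)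

/-- The Bartlett variance estimator `s_n^2` with bandwidth `q`. -/
def bartlettVariance (x : ℕ → ℝ) (n q : ℕ) : ℝ :=
  sampleAutocov x n 0 + 2 * ∑ j ∈ Finset.Icc 1 q, bartlettWeight q j * sampleAutocov x n j

/-- The CUSUM statistic `T_n`, with bandwidth `q`. The Bartlett estimator is always nonnegative, so
the square root is the genuine one; the value is `0` if `s_n = 0`. -/
def cusumStatistic (x : ℕ → ℝ) (n q : ℕ) : ℝ :=
  maxCusum x n / (Real.sqrt n * Real.sqrt (bartlettVariance x n q))

end ChangePoint

end

/-!
The argument compares the CUSUM at the true change point with the Bartlett estimator.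

*Numerator.* At `k*` the CUSUM of the sample is at least the drift `n |Δ| (k*/n) (1 - k*/n)`, less
the CUSUM of the errors (`drift_le_cusum`). Summable autocovariances give sums of `m` errors a
second moment of order `m` (`WeaklyDependent.integral_sum_sq_le`). So after division by `√n` the
errors contribute `O_P(1)`, whereas the drift is of order `√n |Δ|` and diverges.

*Denominator.* The Bartlett weight `1 - |a - b| / (q + 1)` is, up to the factor `q + 1`, the number
of windows of length `q + 1` that contain both `a` and `b`. Hence `n (q + 1) s_n²` is the sum of the
squares of all window sums of the centred sample (`bartlettVariance_eq_sum_sq`). This has two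
consequences. First, `s_n² = O_P(1)`: the errors contribute a bounded mean, and the level shift at
most a multiple of `q Δ²` (`bartlettVariance_le`). Secondly, `s_n = 0` forces the sample to be
constant, so that its CUSUM vanishes as well; thus the convention `T_n = 0` for `s_n = 0` costs
nothing (`cusum_le_of_cusumStatistic_le`).

On `{T_n ≤ M}` the squared drift, divided by `n`, is therefore at most a quadratic form in the errors
(`drift_sq_le_driftBound`) whose mean stays bounded (`WeaklyDependent.integral_driftBound_le`), and
Markov's inequality concludes.
-/

namespace ChangePoint

/-! ### The Bartlett estimator as a sum of squares -/

/-- The part of the sample `{1, …, n}` seen by the window `{m - q, …, m}` of length `q + 1`. -/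
def window (n q m : ℕ) : Finset ℕ := {i ∈ Finset.Icc 1 n | i ≤ m ∧ m ≤ i + q}

theorem card_window_le (n q m : ℕ) : (window n q m).card ≤ q + 1 := by
  have h : window n q m ⊆ Finset.Icc (m - q) m := by
    intro i hi
    simp only [window, Finset.mem_filter, Finset.mem_Icc] at hi ⊢
    omega
  have := Finset.card_le_card h
  rw [Nat.card_Icc] at this
  omega

/-- `#{m : a, b ∈ window m} = (q + 1 - |a - b|)⁺`, written with the Bartlett weights summed over
the lags. -/
theorem card_common_windows (n q a b : ℕ) (ha : a ∈ Finset.Icc 1 n) (hb : b ∈ Finset.Icc 1 n) :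
    (∑ m ∈ Finset.Icc 1 (n + q),
      (if a ≤ m ∧ m ≤ a + q then (1 : ℝ) else 0) * (if b ≤ m ∧ m ≤ b + q then (1 : ℝ) else 0)) =
    (q + 1) * ((if b = a then (1 : ℝ) else 0)
      + ∑ j ∈ Finset.Icc 1 q, bartlettWeight q j * (if b = a + j then (1 : ℝ) else 0)
      + ∑ j ∈ Finset.Icc 1 q, bartlettWeight q j * (if a = b + j then (1 : ℝ) else 0)) := by
  rw [Finset.mem_Icc] at ha hb
  have key : ∀ c d : ℕ, c ≤ d →
      ∑ j ∈ Finset.Icc 1 q, bartlettWeight q j * (if c = d + j then (1 : ℝ) else 0) = 0 := by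
    intro c d hcd
    refine Finset.sum_eq_zero fun j hj => ?_
    rw [Finset.mem_Icc] at hj
    rw [if_neg (by omega), mul_zero]
  have key2 : ∀ c d : ℕ, d < c →
      (q + 1) * ∑ j ∈ Finset.Icc 1 q, bartlettWeight q j * (if c = d + j then (1 : ℝ) else 0)
        = ((d + q + 1 - c : ℕ) : ℝ) := by
    intro c d hcd
    by_cases h : c - d ≤ q
    · rw [Finset.sum_eq_single_of_mem (c - d) (Finset.mem_Icc.2 ⟨by omega, h⟩)
        (fun j _ hj => by rw [if_neg (by omega), mul_zero]), if_pos (by omega), bartlettWeight,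
        Nat.cast_sub hcd.le, Nat.cast_sub (by omega)]
      push_cast
      field_simp
      ring
    · rw [Finset.sum_eq_zero]
      · rw [Nat.sub_eq_zero_of_le (by omega)]; simp
      · intro j hj
        rw [Finset.mem_Icc] at hj
        rw [if_neg (by omega), mul_zero]
  have hcard : (∑ m ∈ Finset.Icc 1 (n + q),
      (if a ≤ m ∧ m ≤ a + q then (1 : ℝ) else 0) * (if b ≤ m ∧ m ≤ b + q then (1 : ℝ) else 0))
      = ((min a b + q + 1 - max a b : ℕ) : ℝ) := by
    rw [← Nat.card_Icc, Finset.cast_card,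
      ← Finset.sum_subset (s₁ := Finset.Icc (max a b) (min a b + q))]
    · refine Finset.sum_congr rfl fun m hm => ?_
      rw [Finset.mem_Icc] at hm
      rw [if_pos (by omega), if_pos (by omega), one_mul]
    · intro m hm
      rw [Finset.mem_Icc] at hm ⊢
      omega
    · intro m _ hm
      rw [Finset.mem_Icc] at hm
      by_cases h : a ≤ m ∧ m ≤ a + q
      · rw [if_neg (c := b ≤ m ∧ _) (by omega), mul_zero]
      · rw [if_neg h, zero_mul]
  rw [hcard, mul_add, mul_add]
  rcases lt_trichotomy a b with h | h | h
  · rw [if_neg h.ne', key2 b a h, key a b h.le, min_eq_left h.le, max_eq_right h.le]; ring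
  · subst h
    rw [if_pos rfl, key a a le_rfl, min_self, max_self]
    have : a + q + 1 - a = q + 1 := by omega
    rw [this]; push_cast; ring
  · rw [if_neg h.ne, key b a h.le, key2 a b h, min_eq_right h.le, max_eq_left h.le]; ring

theorem sum_lagged_products (z : ℕ → ℝ) (n j : ℕ) :
    ∑ i ∈ Finset.Icc 1 (n - j), z i * z (i + j) =
      ∑ a ∈ Finset.Icc 1 n, ∑ b ∈ Finset.Icc 1 n, z a * z b * (if b = a + j then 1 else 0) := by
  rw [← Finset.sum_subset (s₁ := Finset.Icc 1 (n - j)) (s₂ := Finset.Icc 1 n)]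
  · refine Finset.sum_congr rfl fun a ha => ?_
    rw [Finset.mem_Icc] at ha
    simp only [mul_ite, mul_one, mul_zero]
    rw [Finset.sum_ite_eq', if_pos (Finset.mem_Icc.2 ⟨by omega, by omega⟩)]
  · exact Finset.Icc_subset_Icc le_rfl (Nat.sub_le _ _)
  · intro a ha h
    rw [Finset.mem_Icc] at ha h
    refine Finset.sum_eq_zero fun b hb => ?_
    rw [Finset.mem_Icc] at hb
    rw [if_neg (by omega), mul_zero]

/-- The Bartlett estimator is a sum of squares: up to the factor `n (q + 1)` it adds up the squared
sums of the centred sample over all windows of length `q + 1`. -/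
theorem bartlettVariance_eq_sum_sq (x : ℕ → ℝ) {n : ℕ} (hn : n ≠ 0) (q : ℕ) :
    (n : ℝ) * (q + 1) * bartlettVariance x n q =
      ∑ m ∈ Finset.Icc 1 (n + q), (∑ i ∈ window n q m, (x i - sampleMean x n)) ^ 2 := by
  have hn' : (n : ℝ) ≠ 0 := Nat.cast_ne_zero.2 hn
  set z : ℕ → ℝ := fun i => x i - sampleMean x n with hz
  have hA : ∀ j, (n : ℝ) * sampleAutocov x n j =
      ∑ a ∈ Finset.Icc 1 n, ∑ b ∈ Finset.Icc 1 n, z a * z b * (if b = a + j then 1 else 0) := by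
    intro j
    rw [sampleAutocov, mul_inv_cancel_left₀ hn', ← sum_lagged_products]
  have hA' : ∀ j, (n : ℝ) * sampleAutocov x n j =
      ∑ a ∈ Finset.Icc 1 n, ∑ b ∈ Finset.Icc 1 n, z a * z b * (if a = b + j then 1 else 0) := by
    intro j
    rw [hA, Finset.sum_comm]
    exact Finset.sum_congr rfl fun a _ => Finset.sum_congr rfl fun b _ => by rw [mul_comm (z b)]
  have hsum : ∀ c : ℕ → ℕ → ℕ → ℝ, (∀ j, (n : ℝ) * sampleAutocov x n j =
      ∑ a ∈ Finset.Icc 1 n, ∑ b ∈ Finset.Icc 1 n, z a * z b * c j a b) →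
      (n : ℝ) * ∑ j ∈ Finset.Icc 1 q, bartlettWeight q j * sampleAutocov x n j =
      ∑ a ∈ Finset.Icc 1 n, ∑ b ∈ Finset.Icc 1 n,
        z a * z b * ∑ j ∈ Finset.Icc 1 q, bartlettWeight q j * c j a b := by
    intro c hc
    rw [Finset.mul_sum, Finset.sum_congr rfl fun j _ => by rw [mul_left_comm, hc j]]
    simp only [Finset.mul_sum]
    rw [Finset.sum_comm]
    refine Finset.sum_congr rfl fun a _ => ?_
    rw [Finset.sum_comm]
    exact Finset.sum_congr rfl fun b _ => Finset.sum_congr rfl fun j _ => by ring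
  have hB : (n : ℝ) * bartlettVariance x n q =
      ∑ a ∈ Finset.Icc 1 n, ∑ b ∈ Finset.Icc 1 n, z a * z b *
        ((if b = a then (1 : ℝ) else 0)
      + ∑ j ∈ Finset.Icc 1 q, bartlettWeight q j * (if b = a + j then (1 : ℝ) else 0)
      + ∑ j ∈ Finset.Icc 1 q, bartlettWeight q j * (if a = b + j then (1 : ℝ) else 0)) := by
    have h0 := hA 0
    have h1 := hsum (fun j a b => if b = a + j then 1 else 0) hA
    have h2 := hsum (fun j a b => if a = b + j then 1 else 0) hA'
    simp only [mul_add, Finset.sum_add_distrib]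
    simp only [add_zero] at h0
    rw [← h0, ← h1, ← h2, bartlettVariance]
    ring
  have hV : ∀ m, ∑ i ∈ window n q m, z i =
      ∑ i ∈ Finset.Icc 1 n, z i * (if i ≤ m ∧ m ≤ i + q then (1 : ℝ) else 0) := by
    intro m
    simp only [window, Finset.sum_filter, mul_ite, mul_one, mul_zero]
  simp only [hV, sq, Finset.sum_mul_sum]
  rw [Finset.sum_comm, mul_right_comm, hB, Finset.sum_mul]
  refine Finset.sum_congr rfl fun a ha => ?_
  rw [Finset.sum_comm, Finset.sum_mul]
  refine Finset.sum_congr rfl fun b hb => ?_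
  rw [mul_assoc, mul_comm _ ((q : ℝ) + 1), ← card_common_windows n q a b ha hb, Finset.mul_sum]
  exact Finset.sum_congr rfl fun m _ => by ring

theorem bartlettVariance_nonneg (x : ℕ → ℝ) {n : ℕ} (hn : n ≠ 0) (q : ℕ) :
    0 ≤ bartlettVariance x n q := by
  have h : 0 ≤ (n : ℝ) * (q + 1) * bartlettVariance x n q := by
    rw [bartlettVariance_eq_sum_sq x hn]
    positivity
  have hn' : (0 : ℝ) < n := Nat.cast_pos.2 (Nat.pos_of_ne_zero hn)
  exact nonneg_of_mul_nonneg_right h (by positivity)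

/-- The Bartlett estimator vanishes only for a constant sample: the windows ending at
`1, 2, …, n` recover the centred observations one after the other. -/
theorem eq_sampleMean_of_bartlettVariance_eq_zero {x : ℕ → ℝ} {n q : ℕ} (hn : n ≠ 0)
    (h : bartlettVariance x n q = 0) : ∀ i ∈ Finset.Icc 1 n, x i = sampleMean x n := by
  have h0 := bartlettVariance_eq_sum_sq x hn q
  rw [h, mul_zero, eq_comm, Finset.sum_eq_zero_iff_of_nonneg fun _ _ => sq_nonneg _] at h0
  intro i
  induction i using Nat.strong_induction_on with
  | _ i ih =>
    intro hi
    have hi' := Finset.mem_Icc.1 hi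
    have h1 := pow_eq_zero_iff (two_ne_zero) |>.1 (h0 i (Finset.mem_Icc.2 ⟨hi'.1, by omega⟩))
    rw [Finset.sum_eq_single_of_mem i] at h1
    · exact sub_eq_zero.1 h1
    · simp only [window, Finset.mem_filter]
      exact ⟨hi, le_rfl, by omega⟩
    · intro b hb hbi
      simp only [window, Finset.mem_filter] at hb
      exact sub_eq_zero.2 (ih b (by omega) hb.1)

/-! ### The CUSUM process and the statistic -/

theorem cusum_eq_zero_of_const {x : ℕ → ℝ} {n k : ℕ} {c : ℝ} (hn : n ≠ 0) (hk : k ≤ n)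
    (h : ∀ i ∈ Finset.Icc 1 n, x i = c) : cusum x n k = 0 := by
  have hn' : (n : ℝ) ≠ 0 := Nat.cast_ne_zero.2 hn
  rw [cusum, Finset.sum_congr rfl h,
    Finset.sum_congr rfl fun i hi => h i (Finset.Icc_subset_Icc le_rfl hk hi)]
  simp only [Finset.sum_const, Nat.card_Icc, add_tsub_cancel_right, nsmul_eq_mul]
  rw [abs_eq_zero]
  field_simp
  ring

theorem cusum_le_maxCusum (x : ℕ → ℝ) {n k : ℕ} (hk : k ∈ Finset.Icc 1 n) :
    cusum x n k ≤ maxCusum x n :=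
  le_ciSup (f := fun k : Finset.Icc 1 n => cusum x n k) (Set.finite_range _).bddAbove ⟨k, hk⟩

/-- An upper bound on the statistic bounds every CUSUM value. The convention `T_n = 0` for
`s_n = 0` does no harm, as then the sample is constant and the CUSUM process vanishes. -/
theorem cusum_le_of_cusumStatistic_le {x : ℕ → ℝ} {n q k : ℕ} {M : ℝ} (hk : k ∈ Finset.Icc 1 n)
    (h : cusumStatistic x n q ≤ M) :
    cusum x n k ≤ |M| * (√n * √(bartlettVariance x n q)) := by
  have hk' := Finset.mem_Icc.1 hk
  have hn : n ≠ 0 := by omega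
  rcases (bartlettVariance_nonneg x hn q).eq_or_lt with h0 | h0
  · rw [cusum_eq_zero_of_const hn hk'.2 (eq_sampleMean_of_bartlettVariance_eq_zero hn h0.symm)]
    positivity
  · have hn' : (0 : ℝ) < n := Nat.cast_pos.2 (Nat.pos_of_ne_zero hn)
    refine (cusum_le_maxCusum x hk).trans ?_
    rw [← div_le_iff₀ (mul_pos (Real.sqrt_pos.2 hn') (Real.sqrt_pos.2 h0))]
    exact h.trans (le_abs_self M)

/-! ### Samples with a change point -/

section Deterministic

variable {x y : ℕ → ℝ} {μ δ : ℝ} {n k : ℕ}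

theorem sum_changePoint (hx : ∀ i ∈ Finset.Icc 1 n, x i = if i ≤ k then μ + y i else μ + δ + y i)
    (hk : k ≤ n) :
    ∑ i ∈ Finset.Icc 1 n, x i = n * μ + (n - k) * δ + ∑ i ∈ Finset.Icc 1 n, y i := by
  have h1 : ∀ i ∈ Finset.Icc 1 n, x i = μ + (δ - if i ≤ k then δ else 0) + y i := by
    intro i hi
    rw [hx i hi]
    split_ifs <;> ring
  have h2 : Finset.filter (fun i => i ≤ k) (Finset.Icc 1 n) = Finset.Icc 1 k := by
    ext i
    simp only [Finset.mem_filter, Finset.mem_Icc]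
    omega
  rw [Finset.sum_congr rfl h1, Finset.sum_add_distrib, Finset.sum_add_distrib,
    Finset.sum_sub_distrib, ← Finset.sum_filter, h2]
  simp only [Finset.sum_const, Nat.card_Icc, add_tsub_cancel_right, nsmul_eq_mul]
  ring

/-- At the change point the CUSUM has the drift `n |δ| (k/n) (1 - k/n)`, up to the CUSUM of the
errors. -/
theorem drift_le_cusum
    (hx : ∀ i ∈ Finset.Icc 1 n, x i = if i ≤ k then μ + y i else μ + δ + y i)
    (hn : n ≠ 0) (hk : k ≤ n) :
    n * (|δ| * ((k / n : ℝ) * (1 - k / n))) ≤ cusum x n k + cusum y n k := by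
  have hn' : (n : ℝ) ≠ 0 := Nat.cast_ne_zero.2 hn
  have hn0 : (0 : ℝ) < n := Nat.cast_pos.2 (Nat.pos_of_ne_zero hn)
  have h1 : (k / n : ℝ) ≤ 1 := (div_le_one hn0).2 (Nat.cast_le.2 hk)
  have hxk : ∑ i ∈ Finset.Icc 1 k, x i = k * μ + ∑ i ∈ Finset.Icc 1 k, y i := by
    rw [sum_changePoint (k := k) (fun i hi => hx i (Finset.Icc_subset_Icc le_rfl hk hi)) le_rfl]
    ring
  have h2 : (n : ℝ) * (|δ| * ((k / n : ℝ) * (1 - k / n))) =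
      |(∑ i ∈ Finset.Icc 1 k, y i - (k / n : ℝ) * ∑ i ∈ Finset.Icc 1 n, y i)
        - (∑ i ∈ Finset.Icc 1 k, x i - (k / n : ℝ) * ∑ i ∈ Finset.Icc 1 n, x i)| := by
    rw [hxk, sum_changePoint hx hk, mul_left_comm (n : ℝ) |δ|, ← abs_of_nonneg
      (show (0 : ℝ) ≤ n * ((k / n : ℝ) * (1 - k / n)) from
        mul_nonneg hn0.le (mul_nonneg (by positivity) (by linarith))), ← abs_mul]
    congr 1
    field_simp
    ring
  rw [h2, add_comm]
  exact abs_sub _ _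

/-- The Bartlett estimator of the sample is bounded by the window sums and the mean of the errors,
up to a contribution of order `q δ²` of the level shift. -/
theorem bartlettVariance_le
    (hx : ∀ i ∈ Finset.Icc 1 n, x i = if i ≤ k then μ + y i else μ + δ + y i)
    (hn : n ≠ 0) (hk : k ≤ n) (q : ℕ) :
    (n : ℝ) * (q + 1) * bartlettVariance x n q ≤
      3 * (∑ m ∈ Finset.Icc 1 (n + q), (∑ i ∈ window n q m, y i) ^ 2 +
        (n + q) * (q + 1) ^ 2 * ((∑ i ∈ Finset.Icc 1 n, y i) ^ 2 / n ^ 2 + δ ^ 2)) := by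
  have hn' : (n : ℝ) ≠ 0 := Nat.cast_ne_zero.2 hn
  have hn0 : (0 : ℝ) < n := Nat.cast_pos.2 (Nat.pos_of_ne_zero hn)
  have hk1 : (k / n : ℝ) ≤ 1 := (div_le_one hn0).2 (Nat.cast_le.2 hk)
  have hk0 : (0 : ℝ) ≤ k / n := by positivity
  have hmean : sampleMean x n = μ + (1 - k / n) * δ + (∑ i ∈ Finset.Icc 1 n, y i) / n := by
    rw [sampleMean, sum_changePoint hx hk]
    field_simp
  have hm : ∀ m ∈ Finset.Icc 1 (n + q), (∑ i ∈ window n q m, (x i - sampleMean x n)) ^ 2 ≤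
      3 * ((∑ i ∈ window n q m, y i) ^ 2 +
        (q + 1) ^ 2 * ((∑ i ∈ Finset.Icc 1 n, y i) ^ 2 / n ^ 2 + δ ^ 2)) := by
    intro m _
    set S := ∑ i ∈ Finset.Icc 1 n, y i
    have hc : ((window n q m).card : ℝ) ≤ q + 1 := by exact_mod_cast card_window_le n q m
    set d : ℕ → ℝ := fun i => (if i ≤ k then 0 else δ) - (1 - k / n) * δ with hd
    have hdle : ∀ i, |d i| ≤ |δ| := by
      intro i
      simp only [hd]
      split_ifs
      · rw [zero_sub, abs_neg, abs_mul, abs_of_nonneg (by linarith : (0 : ℝ) ≤ 1 - k / n)]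
        exact mul_le_of_le_one_left (abs_nonneg _) (by linarith)
      · rw [show δ - (1 - k / n) * δ = k / n * δ by ring, abs_mul, abs_of_nonneg hk0]
        exact mul_le_of_le_one_left (abs_nonneg _) hk1
    have hsum : ∑ i ∈ window n q m, (x i - sampleMean x n) =
        ∑ i ∈ window n q m, y i + ∑ i ∈ window n q m, d i - (window n q m).card * (S / n) := by
      rw [← nsmul_eq_mul, ← Finset.sum_const, ← Finset.sum_add_distrib, ← Finset.sum_sub_distrib]
      refine Finset.sum_congr rfl fun i hi => ?_
      rw [hmean, hx i (Finset.mem_of_mem_filter i hi)]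
      simp only [hd]
      split_ifs <;> ring
    have hD : (∑ i ∈ window n q m, d i) ^ 2 ≤ (q + 1) ^ 2 * δ ^ 2 := by
      rw [← mul_pow, sq_le_sq, abs_mul, abs_of_nonneg (by positivity : (0 : ℝ) ≤ q + 1)]
      refine (Finset.abs_sum_le_sum_abs _ _).trans
        ((Finset.sum_le_card_nsmul _ _ _ fun i _ => hdle i).trans ?_)
      rw [nsmul_eq_mul]
      gcongr
    have hS : ((window n q m).card * (S / n)) ^ 2 ≤ (q + 1) ^ 2 * (S ^ 2 / n ^ 2) := by
      rw [mul_pow, div_pow]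
      gcongr
    rw [hsum]
    generalize ∑ i ∈ window n q m, y i = A at *
    generalize ∑ i ∈ window n q m, d i = B at *
    generalize (window n q m).card * (S / n) = C at *
    nlinarith [sq_nonneg (A - B), sq_nonneg (A + C), sq_nonneg (B + C)]
  rw [bartlettVariance_eq_sum_sq x hn]
  refine (Finset.sum_le_sum hm).trans (le_of_eq ?_)
  rw [← Finset.mul_sum, Finset.sum_add_distrib, Finset.sum_const, Nat.card_Icc, nsmul_eq_mul]
  push_cast [add_tsub_cancel_right]
  ring

theorem cusum_sq_le (y : ℕ → ℝ) (hn : n ≠ 0) (hk : k ≤ n) :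
    cusum y n k ^ 2 ≤ 2 * ((∑ i ∈ Finset.Icc 1 k, y i) ^ 2 + (∑ i ∈ Finset.Icc 1 n, y i) ^ 2) := by
  have hn0 : (0 : ℝ) < n := Nat.cast_pos.2 (Nat.pos_of_ne_zero hn)
  have hk1 : (k / n : ℝ) ≤ 1 := (div_le_one hn0).2 (Nat.cast_le.2 hk)
  have hk0 : (0 : ℝ) ≤ k / n := by positivity
  rw [cusum, sq_abs]
  generalize ∑ i ∈ Finset.Icc 1 k, y i = A
  generalize ∑ i ∈ Finset.Icc 1 n, y i = B
  have h : (k / n * B : ℝ) ^ 2 ≤ B ^ 2 := by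
    rw [mul_pow]
    exact mul_le_of_le_one_left (sq_nonneg _) (pow_le_one₀ hk0 hk1)
  nlinarith [sq_nonneg (A + k / n * B)]

/-- A quadratic form in the errors that dominates the squared drift, divided by `n`, as soon as the
statistic is at most `M`. -/
noncomputable def driftBound (y : ℕ → ℝ) (δ M : ℝ) (n k q : ℕ) : ℝ :=
  4 * ((∑ i ∈ Finset.Icc 1 k, y i) ^ 2 + (∑ i ∈ Finset.Icc 1 n, y i) ^ 2) / n +
    6 * M ^ 2 * (∑ m ∈ Finset.Icc 1 (n + q), (∑ i ∈ window n q m, y i) ^ 2 +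
        (n + q) * (q + 1) ^ 2 * ((∑ i ∈ Finset.Icc 1 n, y i) ^ 2 / n ^ 2 + δ ^ 2))
      / (n * (q + 1))

theorem driftBound_nonneg (y : ℕ → ℝ) (δ M : ℝ) (n k q : ℕ) : 0 ≤ driftBound y δ M n k q := by
  unfold driftBound
  positivity

theorem drift_sq_le_driftBound
    (hx : ∀ i ∈ Finset.Icc 1 n, x i = if i ≤ k then μ + y i else μ + δ + y i)
    (hk : k ∈ Finset.Icc 1 n) {q : ℕ} {M : ℝ} (h : cusumStatistic x n q ≤ M) :
    n * δ ^ 2 * ((k / n : ℝ) * (1 - k / n)) ^ 2 ≤ driftBound y δ M n k q := by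
  have hk' := Finset.mem_Icc.1 hk
  have hn : n ≠ 0 := by omega
  have hn0 : (0 : ℝ) < n := Nat.cast_pos.2 (Nat.pos_of_ne_zero hn)
  have hk1 : (k / n : ℝ) ≤ 1 := (div_le_one hn0).2 (Nat.cast_le.2 hk'.2)
  have hk0 : (0 : ℝ) ≤ k / n := by positivity
  have h1 := drift_le_cusum hx hn hk'.2
  have h2 := cusum_le_of_cusumStatistic_le hk h
  have h3 := bartlettVariance_le hx hn hk'.2 q
  have h4 := cusum_sq_le y hn hk'.2
  have hv := bartlettVariance_nonneg x hn q
  have h0 : 0 ≤ (n : ℝ) * (|δ| * ((k / n : ℝ) * (1 - k / n))) := by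
    have : (0 : ℝ) ≤ 1 - k / n := by linarith
    positivity
  have h5 : ((n : ℝ) * (|δ| * ((k / n : ℝ) * (1 - k / n)))) ^ 2 ≤
      2 * cusum y n k ^ 2 + 2 * (M ^ 2 * (n * bartlettVariance x n q)) := by
    have h6 : (|M| * (√n * √(bartlettVariance x n q))) ^ 2 =
        M ^ 2 * (n * bartlettVariance x n q) := by
      rw [mul_pow, mul_pow, sq_abs, Real.sq_sqrt hn0.le, Real.sq_sqrt hv]
    rw [← h6]
    have h7 := pow_le_pow_left₀ h0 (h1.trans (add_le_add_left h2 _)) 2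
    refine h7.trans ?_
    generalize |M| * (√n * √(bartlettVariance x n q)) = A
    nlinarith [sq_nonneg (A - cusum y n k)]
  have h8 : (n : ℝ) * δ ^ 2 * ((k / n : ℝ) * (1 - k / n)) ^ 2 =
      ((n : ℝ) * (|δ| * ((k / n : ℝ) * (1 - k / n)))) ^ 2 / n := by
    rw [mul_pow (n : ℝ), mul_pow |δ|, sq_abs]
    field_simp
  have h9 := (le_div_iff₀' (by positivity : (0 : ℝ) < n * (q + 1))).2 h3
  rw [h8, driftBound]
  set U := ∑ m ∈ Finset.Icc 1 (n + q), (∑ i ∈ window n q m, y i) ^ 2 +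
        (n + q) * (q + 1) ^ 2 * ((∑ i ∈ Finset.Icc 1 n, y i) ^ 2 / n ^ 2 + δ ^ 2)
  calc _ ≤ (2 * cusum y n k ^ 2 + 2 * (M ^ 2 * (n * bartlettVariance x n q))) / n := by gcongr
    _ = 2 * cusum y n k ^ 2 / n + 2 * (M ^ 2 * bartlettVariance x n q) := by field_simp
    _ ≤ 2 * (2 * ((∑ i ∈ Finset.Icc 1 k, y i) ^ 2 + (∑ i ∈ Finset.Icc 1 n, y i) ^ 2)) / n
        + 2 * (M ^ 2 * (3 * U / (n * (q + 1)))) := by gcongr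
    _ = _ := by ring

end Deterministic

/-! ### Second moments of the errors -/

section Moments

variable {Ω : Type*} [MeasurableSpace Ω] {P : Measure Ω} [IsProbabilityMeasure P] {Y : ℤ → Ω → ℝ}

theorem FourthOrderStationary.memLp_two (hs : FourthOrderStationary Y P) (k : ℤ) :
    MemLp (Y k) 2 P :=
  (hs.memLp k).mono_exponent (by norm_num)

theorem FourthOrderStationary.integral_mul (hs : FourthOrderStationary Y P)
    (hm : ∀ k, ∫ ω, Y k ω ∂P = 0) (i j : ℤ) :
    ∫ ω, Y i ω * Y j ω ∂P = autocov Y P (j - i) := by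
  have h := hs.moment_shift 2 (by norm_num) ![0, j - i] i
  simp only [Fin.prod_univ_two, Matrix.cons_val_zero, Matrix.cons_val_one, zero_add,
    sub_add_cancel] at h
  rw [h, autocov, covariance_eq_sub (hs.memLp_two 0) (hs.memLp_two _), hm, zero_mul, sub_zero]
  rfl

theorem FourthOrderStationary.integrable_sum_sq (hs : FourthOrderStationary Y P) (F : Finset ℕ) :
    Integrable (fun ω => (∑ i ∈ F, Y (i : ℤ) ω) ^ 2) P :=
  (memLp_finsetSum F fun i _ => hs.memLp_two (i : ℤ)).integrable_sq

/-- Summable autocovariances give sums of errors a second moment linear in their length. -/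
theorem WeaklyDependent.integral_sum_sq_le (hY : WeaklyDependent Y P) (F : Finset ℕ) :
    ∫ ω, (∑ i ∈ F, Y (i : ℤ) ω) ^ 2 ∂P ≤ F.card * ∑' j : ℤ, |autocov Y P j| := by
  have hs := hY.stationary
  have hint : ∀ i j : ℤ, Integrable (fun ω => Y i ω * Y j ω) P := fun i j =>
    (hs.memLp_two i).integrable_mul (hs.memLp_two j)
  simp only [sq, Finset.sum_mul_sum]
  rw [integral_finsetSum _ fun (i : ℕ) _ => integrable_finsetSum _ fun (j : ℕ) _ => hint i j,
    ← nsmul_eq_mul]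
  refine Finset.sum_le_card_nsmul _ _ _ fun i _ => ?_
  rw [integral_finsetSum _ fun (j : ℕ) _ => hint i j]
  simp only [hs.integral_mul hY.mean_zero]
  refine (Finset.sum_le_sum fun j _ => le_abs_self _).trans ?_
  have hinj : Function.Injective fun j : ℕ => (j : ℤ) - i := fun a b h => by
    simpa using h
  refine (Finset.sum_map F ⟨_, hinj⟩ fun j => |autocov Y P j|).symm.trans_le ?_
  exact hY.summable_autocov.sum_le_tsum _ fun _ _ => abs_nonneg _

theorem FourthOrderStationary.integrable_driftBound (hs : FourthOrderStationary Y P) (δ M : ℝ)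
    (n k q : ℕ) : Integrable (fun ω => driftBound (fun i => Y (i : ℤ) ω) δ M n k q) P := by
  have h := hs.integrable_sum_sq
  unfold driftBound
  exact ((((h _).add (h _)).const_mul 4).div_const _).add
    ((((integrable_finsetSum _ fun m _ => h _).add
      ((((h _).div_const _).add (integrable_const _)).const_mul _)).const_mul _).div_const _)

theorem WeaklyDependent.integral_driftBound_le (hY : WeaklyDependent Y P) (δ M : ℝ)
    {n k : ℕ} (q : ℕ) (hn : n ≠ 0) (hk : k ≤ n) :
    ∫ ω, driftBound (fun i => Y (i : ℤ) ω) δ M n k q ∂P ≤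
      8 * (∑' j : ℤ, |autocov Y P j|) + 6 * M ^ 2 * (1 + q / n) *
        (∑' j : ℤ, |autocov Y P j| +
          (q + 1) * ((∑' j : ℤ, |autocov Y P j|) / n + δ ^ 2)) := by
  have h := hY.stationary.integrable_sum_sq
  have hle := hY.integral_sum_sq_le
  set Γ := ∑' j : ℤ, |autocov Y P j|
  have hΓ : 0 ≤ Γ := tsum_nonneg fun _ => abs_nonneg _
  have hn0 : (0 : ℝ) < n := Nat.cast_pos.2 (Nat.pos_of_ne_zero hn)
  have hk1 : (k : ℝ) ≤ n := Nat.cast_le.2 hk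
  have hw : ∀ m, ∫ ω, (∑ i ∈ window n q m, Y (i : ℤ) ω) ^ 2 ∂P ≤ (q + 1) * Γ := by
    intro m
    refine (hle _).trans (mul_le_mul_of_nonneg_right ?_ hΓ)
    exact_mod_cast card_window_le n q m
  have hIcc : ∀ l : ℕ, ∫ ω, (∑ i ∈ Finset.Icc 1 l, Y (i : ℤ) ω) ^ 2 ∂P ≤ l * Γ := by
    intro l
    simpa using hle (Finset.Icc 1 l)
  have hkn : ∫ ω, (∑ i ∈ Finset.Icc 1 k, Y (i : ℤ) ω) ^ 2 ∂P ≤ n * Γ :=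
    (hIcc k).trans (mul_le_mul_of_nonneg_right hk1 hΓ)
  have hsum : ∑ m ∈ Finset.Icc 1 (n + q), ∫ ω, (∑ i ∈ window n q m, Y (i : ℤ) ω) ^ 2 ∂P ≤
      (n + q) * ((q + 1) * Γ) := by
    refine (Finset.sum_le_card_nsmul _ _ _ fun m _ => hw m).trans (le_of_eq ?_)
    rw [nsmul_eq_mul, Nat.card_Icc]
    push_cast [add_tsub_cancel_right]
    ring
  unfold driftBound
  have i1 : Integrable (fun ω => ((∑ i ∈ Finset.Icc 1 n, Y (i : ℤ) ω) ^ 2 / n ^ 2 + δ ^ 2)) P :=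
    ((h _).div_const _).add (integrable_const _)
  have i2 : Integrable
      (fun ω => ∑ m ∈ Finset.Icc 1 (n + q), (∑ i ∈ window n q m, Y (i : ℤ) ω) ^ 2) P :=
    integrable_finsetSum _ fun m _ => h _
  have i3 : Integrable (fun ω => ∑ m ∈ Finset.Icc 1 (n + q),
      (∑ i ∈ window n q m, Y (i : ℤ) ω) ^ 2 + (n + q) * (q + 1) ^ 2 *
        ((∑ i ∈ Finset.Icc 1 n, Y (i : ℤ) ω) ^ 2 / n ^ 2 + δ ^ 2)) P :=
    i2.add (i1.const_mul _)
  have i4 : Integrable (fun ω => (∑ i ∈ Finset.Icc 1 k, Y (i : ℤ) ω) ^ 2 +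
      (∑ i ∈ Finset.Icc 1 n, Y (i : ℤ) ω) ^ 2) P :=
    (h _).add (h _)
  rw [integral_add ((i4.const_mul 4).div_const _) ((i3.const_mul _).div_const _),
    integral_div, integral_const_mul, integral_add (h _) (h _), integral_div, integral_const_mul,
    integral_add i2 (i1.const_mul _), integral_finsetSum _ fun m _ => h _, integral_const_mul,
    integral_add ((h _).div_const _) (integrable_const _), integral_div, integral_const]
  simp only [probReal_univ, one_smul]
  calc _ ≤ 4 * (n * Γ + n * Γ) / n + 6 * M ^ 2 * ((n + q) * ((q + 1) * Γ) +
        (n + q) * (q + 1) ^ 2 * (n * Γ / n ^ 2 + δ ^ 2)) / (n * (q + 1)) := by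
        gcongr
        exact hIcc n
        exact hIcc n
    _ = _ := by
        field_simp
        ring

end Moments

end ChangePoint

theorem theorem3p2 {Ω : Type*} [MeasurableSpace Ω] (P : Measure Ω) [IsProbabilityMeasure P]
    (Y : ℤ → Ω → ℝ) (hY : ChangePoint.WeaklyDependent Y P)
    (X : ℕ → ℕ → Ω → ℝ) (μ : ℝ) (Δ : ℕ → ℝ) (kstar : ℕ → ℕ)
    (hX : ChangePoint.FollowsChangePointModel X Y μ Δ kstar)
    (θ : ℝ) (hθ0 : 0 < θ) (hθ1 : θ < 1)
    (hkstar : ∀ n : ℕ, kstar n = ⌊(n : ℝ) * θ⌋₊)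
    (hΔ : Tendsto (fun n : ℕ => (n : ℝ) * Δ n ^ 2) atTop atTop)
    (hkhat : ChangePoint.IsBoundedInProbability
      (fun n ω => Δ n ^ 2 *
        |(ChangePoint.changePointEstimator (fun i => X n i ω) n : ℝ) - (kstar n : ℝ)|) P)
    (q : ℕ → ℕ)
    (hqΔ : (fun n : ℕ => (q n : ℝ) * Δ n ^ 2) =O[atTop] (fun _ => (1 : ℝ)))
    (hq : Tendsto q atTop atTop)
    (hqn : Tendsto (fun n : ℕ => (q n : ℝ) / (n : ℝ)) atTop (𝓝 0)) :
    ChangePoint.TendstoInfinityInProbability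
      (fun n ω => ChangePoint.cusumStatistic (fun i => X n i ω) n (q n)) P := by
  have hs := hY.stationary
  set Γ := ∑' j : ℤ, |ChangePoint.autocov Y P j| with hΓdef
  have hΓ : 0 ≤ Γ := tsum_nonneg fun _ => abs_nonneg _
  intro M
  have hfrac : Tendsto (fun n : ℕ => (kstar n : ℝ) / n) atTop (𝓝 θ) := by
    have h := (tendsto_nat_floor_mul_div_atTop hθ0.le).comp tendsto_natCast_atTop_atTop
    refine h.congr fun n => ?_
    simp only [Function.comp_apply, hkstar, mul_comm]
  have hdrift : Tendsto (fun n : ℕ => (n : ℝ) * Δ n ^ 2 *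
      ((kstar n / n : ℝ) * (1 - kstar n / n)) ^ 2) atTop atTop := by
    refine hΔ.atTop_mul_pos (C := (θ * (1 - θ)) ^ 2)
      (pow_pos (mul_pos hθ0 (by linarith)) 2) ?_
    exact (hfrac.mul (hfrac.const_sub 1)).pow 2
  obtain ⟨c, hc⟩ := hqΔ.bound
  have hk1 : ∀ᶠ n : ℕ in atTop, kstar n ∈ Finset.Icc 1 n := by
    filter_upwards [(tendsto_natCast_atTop_atTop (R := ℝ)).eventually_ge_atTop θ⁻¹] with n hn
    rw [Finset.mem_Icc, hkstar]
    constructor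
    · rw [Nat.one_le_floor_iff]
      exact (inv_le_iff_one_le_mul₀ hθ0).1 hn
    · exact Nat.floor_le_of_le (mul_le_of_le_one_right (Nat.cast_nonneg n) hθ1.le)
  -- The dominating quadratic form has bounded mean: `q / n ≤ 1`, `q Δ² ≤ c` and `1 ≤ q`.
  have hmean : ∀ᶠ n : ℕ in atTop,
      ∫ ω, ChangePoint.driftBound (fun i => Y (i : ℤ) ω) (Δ n) M n (kstar n) (q n) ∂P ≤
        8 * Γ + 6 * M ^ 2 * (1 + 1) * (Γ + (2 * Γ + 2 * c)) := by
    filter_upwards [hk1, hc, hq.eventually_ge_atTop 1, hqn.eventually_le_const one_pos]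
      with n hk hcn hq1 hqn1
    have hk' := Finset.mem_Icc.1 hk
    have hn : n ≠ 0 := by omega
    have hn0 : (1 : ℝ) ≤ n := by exact_mod_cast Nat.one_le_iff_ne_zero.2 hn
    have hq1' : (1 : ℝ) ≤ q n := by exact_mod_cast hq1
    refine (hY.integral_driftBound_le (Δ n) M (q n) hn hk'.2).trans ?_
    rw [← hΓdef]
    have h1 : (q n : ℝ) * Δ n ^ 2 ≤ c := by
      simpa [abs_of_nonneg (by positivity : 0 ≤ (q n : ℝ) * Δ n ^ 2)] using hcn
    have h2 : ((q n : ℝ) + 1) * (Γ / n + Δ n ^ 2) ≤ 2 * Γ + 2 * c := by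
      have h3 : ((q n : ℝ) + 1) * (Γ / n + Δ n ^ 2) ≤
          (2 * q n) * (Γ / n + Δ n ^ 2) := by
        gcongr
        linarith
      have h4 : (q n : ℝ) / n * Γ ≤ Γ := mul_le_of_le_one_left hΓ hqn1
      calc _ ≤ _ := h3
        _ = 2 * (q n / n * Γ) + 2 * (q n * Δ n ^ 2) := by ring
        _ ≤ _ := by linarith
    gcongr
  set B := 8 * Γ + 6 * M ^ 2 * (1 + 1) * (Γ + (2 * Γ + 2 * c))
  have hlim : Tendsto (fun n : ℕ => ENNReal.ofReal (B / ((n : ℝ) * Δ n ^ 2 *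
      ((kstar n / n : ℝ) * (1 - kstar n / n)) ^ 2))) atTop (𝓝 0) := by
    rw [← ENNReal.ofReal_zero]
    exact (ENNReal.continuous_ofReal.tendsto 0).comp (hdrift.const_div_atTop B)
  refine tendsto_of_tendsto_of_tendsto_of_le_of_le' tendsto_const_nhds hlim
    (Eventually.of_forall fun _ => zero_le) ?_
  filter_upwards [hk1, hmean, hdrift.eventually_gt_atTop 0] with n hk hB hpos
  set D := (n : ℝ) * Δ n ^ 2 * ((kstar n / n : ℝ) * (1 - kstar n / n)) ^ 2
  have hsub : {ω | ChangePoint.cusumStatistic (fun i => X n i ω) n (q n) ≤ M} ⊆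
      {ω | D ≤ ChangePoint.driftBound (fun i => Y (i : ℤ) ω) (Δ n) M n (kstar n) (q n)} := by
    intro ω hω
    refine ChangePoint.drift_sq_le_driftBound (x := fun i => X n i ω) (μ := μ) ?_ hk hω
    intro i hi
    rw [Finset.mem_Icc] at hi
    exact hX n i hi.1 hi.2 ω
  have hmarkov := mul_meas_ge_le_integral_of_nonneg
    (Eventually.of_forall fun ω => ChangePoint.driftBound_nonneg (fun i => Y (i : ℤ) ω) (Δ n) M n
      (kstar n) (q n)) (hs.integrable_driftBound (Δ n) M n (kstar n) (q n)) D
  refine (measure_mono hsub).trans ?_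
  rw [← ofReal_measureReal]
  exact ENNReal.ofReal_le_ofReal ((le_div_iff₀' hpos).2 (hmarkov.trans hB))
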